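/- Let $\mathcal{H}$ be a complex Hilbert space with inner product $\langle\cdot\mid\cdot\rangle$ (linear in the first argument), and let $A$ be a positive bounded linear operator on $\mathcal{H}$. Put $\langle x\mid y\rangle_A=\langle Ax\mid y\rangle$ and $\|x\|_A=\sqrt{\langle x\mid x\rangle_A}$. For a bounded linear operator $T$ on $\mathcal{H}$, let $$\omega_A(T)=\sup\{|\langle Tx\mid x\rangle_A| : x\in\mathcal{H},\ \|x\|_A=1\}\in[0,\infty]$$ be its $A$-numerical radius (with $\sup\emptyset=0$). Let $\mathcal{B}_{A^{1/2}}(\mathcal{H})$ denote the set of $A$-bounded operators, that is, of those bounded $T$ for which there is a bounded $R$ with $\langle A^{1/2}Tx\mid y\rangle=\langle A^{1/2}x\mid Ry\rangle$ for all $x,y\in\mathcal{H}$; equivalently, for which there is $\lambda>0$ with $\|Tx\|_A\le\lambda\|x\|_A$ for all $x\in\mathcal{H}$. Let $T,S\in\mathcal{B}_{A^{1/2}}(\mathcal{H})$. Then $$\omega_A(TS)\le 4\,\omega_A(T)\,\omega_A(S)\qquad\text{and}\qquad \omega_A(TS+ST)\le 4\,\omega_A(T)\,\omega_A(S).$$ If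 moreover $TS=ST$, then $$\omega_A(TS)\le 2\,\omega_A(T)\,\omega_A(S).$$ -/

import Mathlib

open scoped ENNReal

namespace SemiHilbert

noncomputable section

variable {H : Type*} [NormedAddCommGroup H] [InnerProductSpace ℂ H]

/-- The semi-inner product `⟨x | y⟩_A = ⟨A x | y⟩`, linear in `x` and conjugate-linear in `y`
(Mathlib's `inner ℂ` is linear in its second argument). -/
def aInner (A : H →L[ℂ] H) (x y : H) : ℂ := inner ℂ y (A x)

/-- The seminorm `‖x‖_A = √⟨x | x⟩_A`. -/
def aSeminorm (A : H →L[ℂ] H) (x : H) : ℝ := Real.sqrt (aInner A x x).re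

/-- `S` is an `A`-adjoint of `T`: `⟨T x | y⟩_A = ⟨x | S y⟩_A` for all `x`, `y`. -/
def IsAAdjoint (A T S : H →L[ℂ] H) : Prop :=
  ∀ x y : H, aInner A (T x) y = aInner A x (S y)

/-- The `A`-numerical radius `sup {|⟨T x | x⟩_A| : ‖x‖_A = 1}`, as an element of `[0, ∞]`. -/
def aNumRadius (A T : H →L[ℂ] H) : ℝ≥0∞ :=
  ⨆ (x : H) (_ : aSeminorm A x = 1), ‖aInner A (T x) x‖ₑ

variable [CompleteSpace H]

/-- The set of `A`-bounded operators: those admitting an `A^{1/2}`-adjoint.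
See `mem_aBounded_iff` for the description by the seminorm `‖·‖_A`. -/
def aBounded (A : H →L[ℂ] H) : Set (H →L[ℂ] H) :=
  {T | ∃ S : H →L[ℂ] H, IsAAdjoint (CFC.sqrt A) T S}

theorem aSeminorm_eq_norm_sqrt {A : H →L[ℂ] H} (hA : A.IsPositive) (x : H) :
    aSeminorm A x = ‖CFC.sqrt A x‖ := by
  have h0 : 0 ≤ A := (ContinuousLinearMap.nonneg_iff_isPositive A).2 hA
  have hB : (CFC.sqrt A).IsPositive :=
    (ContinuousLinearMap.nonneg_iff_isPositive _).1 (CFC.sqrt_nonneg A)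
  have h1 : A x = CFC.sqrt A (CFC.sqrt A x) := by
    conv_lhs => rw [← CFC.sqrt_mul_sqrt_self A h0]
    rfl
  have h2 : aInner A x x = inner ℂ (CFC.sqrt A x) (CFC.sqrt A x) := by
    rw [aInner, h1]
    exact (hB.isSymmetric x (CFC.sqrt A x)).symm
  rw [aSeminorm, h2, norm_eq_sqrt_re_inner (𝕜 := ℂ)]
  rfl

theorem mem_aBounded_iff {A : H →L[ℂ] H} (hA : A.IsPositive) (T : H →L[ℂ] H) :
    T ∈ aBounded A ↔ ∃ c : ℝ, 0 < c ∧ ∀ x : H, aSeminorm A (T x) ≤ c * aSeminorm A x := by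
  have hB : (CFC.sqrt A).IsPositive :=
    (ContinuousLinearMap.nonneg_iff_isPositive _).1 (CFC.sqrt_nonneg A)
  simp only [aSeminorm_eq_norm_sqrt hA]
  set B := CFC.sqrt A with hBdef
  have hsym : ∀ x y : H, inner ℂ (B x) y = inner ℂ x (B y) := hB.isSymmetric
  constructor
  · rintro ⟨S, hS⟩
    have key : ∀ x, B (T x) = ContinuousLinearMap.adjoint S (B x) := by
      intro x
      refine ext_inner_left ℂ fun y => ?_
      rw [ContinuousLinearMap.adjoint_inner_right]
      exact hS x y
    refine ⟨‖ContinuousLinearMap.adjoint S‖ + 1, by positivity, fun x => ?_⟩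
    rw [key]
    refine (ContinuousLinearMap.le_opNorm _ _).trans ?_
    gcongr
    linarith
  · rintro ⟨c, -, hc⟩
    let K : Submodule ℂ H := (LinearMap.range (B : H →ₗ[ℂ] H)).topologicalClosure
    have hK : ∀ x, B x ∈ K := fun x =>
      Submodule.le_topologicalClosure _ (LinearMap.mem_range_self (B : H →ₗ[ℂ] H) x)
    let e : H →ₗ[ℂ] K := (B : H →ₗ[ℂ] H).codRestrict K hK
    have he : DenseRange e := by
      intro y
      rw [Topology.IsInducing.subtypeVal.closure_eq_preimage_closure_image]
      have h3 : (y : H) ∈ closure (Set.range B) := y.2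
      refine closure_mono ?_ h3
      rintro _ ⟨x, rfl⟩
      exact ⟨e x, ⟨x, rfl⟩, rfl⟩
    have : CompleteSpace K :=
      (Submodule.isClosed_topologicalClosure _).completeSpace_coe
    let f : H →ₗ[ℂ] H := (B * T : H →L[ℂ] H)
    let C : K →L[ℂ] H := f.extendOfNorm e
    have hC : ∀ x, C (e x) = B (T x) := LinearMap.extendOfNorm_eq he ⟨c, hc⟩
    let D : H →L[ℂ] H := C.comp K.orthogonalProjectionOnto
    have hD : ∀ x, D (B x) = B (T x) := by
      intro x
      rw [← hC x]
      change C (K.orthogonalProjectionOnto ((e x : K) : H)) = _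
      rw [Submodule.orthogonalProjectionOnto_mem_subspace_eq_self]
    refine ⟨ContinuousLinearMap.adjoint D, fun x y => ?_⟩
    change inner ℂ y (B (T x)) = inner ℂ (ContinuousLinearMap.adjoint D y) (B x)
    rw [ContinuousLinearMap.adjoint_inner_left, hD]

end

end SemiHilbert

open scoped ENNReal NNReal

namespace SemiHilbert

variable {H : Type*} [NormedAddCommGroup H] [InnerProductSpace ℂ H]

section Algebra

variable (A : H →L[ℂ] H) (x y z : H) (c : ℂ)

/-! Everything rests on the bound `|⟨Tx | x⟩_A| ≤ a ‖x‖_A ^ 2` (`QuadBounded`), valid with `a =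
ω_A(T)`. Polarization and the parallelogram law give `‖Tx‖_A ≤ 2a ‖x‖_A`; two such factors of 2 make
the 4 in the bound for `TS`. For `TS + ST` the tool is the power inequality `ω_A(T²) ≤ ω_A(T)²`
(`QuadBounded.mul_self`), applied to both squares in `(T + S)² - (T - S)² = 2(TS + ST)` after
rescaling `T` and `S` to a common bound. If `TS = ST`, the sum is `2TS`, which halves the constant.
-/

theorem aInner_add_left : aInner A (x + y) z = aInner A x z + aInner A y z := by
  simp [aInner]

theorem aInner_add_right : aInner A x (y + z) = aInner A x y + aInner A x z := by
  simp [aInner]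

theorem aInner_sub_left : aInner A (x - y) z = aInner A x z - aInner A y z := by
  simp [aInner]

theorem aInner_sub_right : aInner A x (y - z) = aInner A x y - aInner A x z := by
  simp [aInner]

theorem aInner_smul_left : aInner A (c • x) y = c * aInner A x y := by
  simp [aInner]

theorem aInner_smul_right : aInner A x (c • y) = starRingEnd ℂ c * aInner A x y := by
  simp [aInner, mul_comm]

end Algebra

variable {A : H →L[ℂ] H}

theorem aSeminorm_nonneg (A : H →L[ℂ] H) (x : H) : 0 ≤ aSeminorm A x := Real.sqrt_nonneg _

/-- The quadratic form of `T` is bounded by `a ‖·‖_A ^ 2`. -/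
def QuadBounded (A T : H →L[ℂ] H) (a : ℝ) : Prop :=
  ∀ x, ‖aInner A (T x) x‖ ≤ a * aSeminorm A x ^ 2

theorem QuadBounded.smul {T : H →L[ℂ] H} {a : ℝ} (h : QuadBounded A T a) (c : ℂ) :
    QuadBounded A (c • T) (‖c‖ * a) := fun x => by
  rw [smul_apply, aInner_smul_left, norm_mul, mul_assoc]
  exact mul_le_mul_of_nonneg_left (h x) (norm_nonneg _)

theorem QuadBounded.add {T S : H →L[ℂ] H} {a b : ℝ} (hT : QuadBounded A T a)
    (hS : QuadBounded A S b) : QuadBounded A (T + S) (a + b) := fun x => by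
  rw [add_apply, aInner_add_left, add_mul]
  exact (norm_add_le _ _).trans (add_le_add (hT x) (hS x))

theorem QuadBounded.sub {T S : H →L[ℂ] H} {a b : ℝ} (hT : QuadBounded A T a)
    (hS : QuadBounded A S b) : QuadBounded A (T - S) (a + b) := fun x => by
  rw [sub_apply, aInner_sub_left, add_mul]
  exact (norm_sub_le _ _).trans (add_le_add (hT x) (hS x))

theorem QuadBounded.aNumRadius_le {T : H →L[ℂ] H} {a : ℝ≥0} (h : QuadBounded A T a) :
    aNumRadius A T ≤ a := by
  refine iSup₂_le fun x hx => ?_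
  have := h x
  rw [hx, one_pow, mul_one] at this
  rw [enorm_eq_nnnorm]
  exact_mod_cast this

variable [CompleteSpace H]

theorem aInner_eq_inner_sqrt (hA : A.IsPositive) (x y : H) :
    aInner A x y = inner ℂ (CFC.sqrt A y) (CFC.sqrt A x) := by
  have h0 : 0 ≤ A := (ContinuousLinearMap.nonneg_iff_isPositive A).2 hA
  have hB : (CFC.sqrt A).IsPositive :=
    (ContinuousLinearMap.nonneg_iff_isPositive _).1 (CFC.sqrt_nonneg A)
  have h1 : A x = CFC.sqrt A (CFC.sqrt A x) := by
    conv_lhs => rw [← CFC.sqrt_mul_sqrt_self A h0]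
    rfl
  rw [aInner, h1]
  exact (hB.isSymmetric y (CFC.sqrt A x)).symm

theorem norm_aInner_le (hA : A.IsPositive) (x y : H) :
    ‖aInner A x y‖ ≤ aSeminorm A x * aSeminorm A y := by
  rw [aInner_eq_inner_sqrt hA, aSeminorm_eq_norm_sqrt hA, aSeminorm_eq_norm_sqrt hA, mul_comm]
  exact norm_inner_le_norm _ _

theorem aInner_self (hA : A.IsPositive) (x : H) : aInner A x x = (aSeminorm A x : ℂ) ^ 2 := by
  rw [aInner_eq_inner_sqrt hA, aSeminorm_eq_norm_sqrt hA]
  exact inner_self_eq_norm_sq_to_K _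

theorem aSeminorm_smul (hA : A.IsPositive) (c : ℂ) (x : H) :
    aSeminorm A (c • x) = ‖c‖ * aSeminorm A x := by
  rw [aSeminorm_eq_norm_sqrt hA, aSeminorm_eq_norm_sqrt hA, map_smul, norm_smul]

theorem aSeminorm_parallelogram (hA : A.IsPositive) (x y : H) :
    aSeminorm A (x + y) ^ 2 + aSeminorm A (x - y) ^ 2 =
      2 * (aSeminorm A x ^ 2 + aSeminorm A y ^ 2) := by
  simp only [aSeminorm_eq_norm_sqrt hA, map_add, map_sub]
  have := parallelogram_law_with_norm ℂ (CFC.sqrt A x) (CFC.sqrt A y)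
  linarith

/-- Polarization: the sesquilinear form of `T` is controlled by its quadratic form. -/
theorem QuadBounded.norm_aInner_le_add {T : H →L[ℂ] H} {a : ℝ} (hA : A.IsPositive)
    (h : QuadBounded A T a) (u v : H) :
    ‖aInner A (T u) v‖ ≤ a * (aSeminorm A u ^ 2 + aSeminorm A v ^ 2) := by
  have key : 4 * aInner A (T u) v =
      (aInner A (T (u + v)) (u + v) - aInner A (T (u - v)) (u - v)) +
        Complex.I * (aInner A (T (u + Complex.I • v)) (u + Complex.I • v) -
          aInner A (T (u - Complex.I • v)) (u - Complex.I • v)) := by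
    simp only [map_add, map_sub, map_smul, aInner_add_left, aInner_add_right, aInner_sub_left,
      aInner_sub_right, aInner_smul_left, aInner_smul_right, Complex.conj_I]
    linear_combination (-2 * aInner A (T v) u + 2 * aInner A (T u) v) * Complex.I_sq
  have p1 := aSeminorm_parallelogram hA u v
  have p2 := aSeminorm_parallelogram hA u (Complex.I • v)
  rw [aSeminorm_smul hA, Complex.norm_I, one_mul] at p2
  have h4 : ‖4 * aInner A (T u) v‖ = 4 * ‖aInner A (T u) v‖ := by simp
  have hle : 4 * ‖aInner A (T u) v‖ ≤
      a * aSeminorm A (u + v) ^ 2 + a * aSeminorm A (u - v) ^ 2 +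
        (a * aSeminorm A (u + Complex.I • v) ^ 2 + a * aSeminorm A (u - Complex.I • v) ^ 2) := by
    rw [← h4, key]
    refine (norm_add_le _ _).trans (add_le_add ?_ ?_)
    · exact (norm_sub_le _ _).trans (add_le_add (h _) (h _))
    · rw [norm_mul, Complex.norm_I, one_mul]
      exact (norm_sub_le _ _).trans (add_le_add (h _) (h _))
  linear_combination hle / 4 + a / 4 * p1 + a / 4 * p2

theorem QuadBounded.norm_aInner_le {T : H →L[ℂ] H} {a : ℝ} (hA : A.IsPositive)
    (hT : T ∈ aBounded A) (h : QuadBounded A T a) (u v : H) :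
    ‖aInner A (T u) v‖ ≤ 2 * a * aSeminorm A u * aSeminorm A v := by
  have h0 := SemiHilbert.norm_aInner_le hA (T u) v
  rcases (aSeminorm_nonneg A v).eq_or_lt' with hv | hv
  · simpa [hv] using h0
  rcases (aSeminorm_nonneg A u).eq_or_lt' with hu | hu
  -- No rescaling of `u` is possible here; `A`-boundedness forces `‖Tu‖_A = 0` instead.
  · obtain ⟨c, -, hc⟩ := (mem_aBounded_iff hA T).1 hT
    have hTu := hc u
    rw [hu, mul_zero] at hTu
    rw [le_antisymm hTu (aSeminorm_nonneg A _), zero_mul] at h0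
    simpa [hu] using h0
  -- Cross-scaling gives both vectors the seminorm `‖u‖_A ‖v‖_A`, so the sum of squares becomes
  -- twice a product.
  have := h.norm_aInner_le_add hA ((aSeminorm A v : ℂ) • u) ((aSeminorm A u : ℂ) • v)
  simp only [map_smul, aInner_smul_left, aInner_smul_right, aSeminorm_smul hA, norm_mul,
    Complex.conj_ofReal, Complex.norm_real, Real.norm_of_nonneg hu.le,
    Real.norm_of_nonneg hv.le] at this
  refine le_of_mul_le_mul_left ?_ (mul_pos hv hu)
  linear_combination this

theorem QuadBounded.aSeminorm_le {T : H →L[ℂ] H} {a : ℝ} (hA : A.IsPositive)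
    (ha : 0 ≤ a) (hT : T ∈ aBounded A) (h : QuadBounded A T a) (u : H) :
    aSeminorm A (T u) ≤ 2 * a * aSeminorm A u := by
  rcases (aSeminorm_nonneg A (T u)).eq_or_lt' with h0 | h0
  · rw [h0]
    exact mul_nonneg (by positivity) (aSeminorm_nonneg A u)
  have := h.norm_aInner_le hA hT u (T u)
  rw [aInner_self hA, norm_pow, Complex.norm_real, Real.norm_of_nonneg h0.le, sq] at this
  exact le_of_mul_le_mul_right this h0

theorem QuadBounded.mul {T S : H →L[ℂ] H} {a b : ℝ} (hA : A.IsPositive)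
    (ha : 0 ≤ a) (hb : 0 ≤ b) (hT : T ∈ aBounded A) (hS : S ∈ aBounded A)
    (hTa : QuadBounded A T a) (hSb : QuadBounded A S b) : QuadBounded A (T * S) (4 * a * b) := by
  intro x
  have h1 := hTa.norm_aInner_le hA hT (S x) x
  have h2 := mul_le_mul_of_nonneg_left (hSb.aSeminorm_le hA hb hS x)
    (mul_nonneg (mul_nonneg zero_le_two ha) (aSeminorm_nonneg A x))
  rw [mul_apply_eq_comp]
  linear_combination h1 + h2

/-- The real-part form of the power inequality for squares. -/
theorem QuadBounded.re_aInner_mul_self_le {T : H →L[ℂ] H} {c : ℝ} (hA : A.IsPositive)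
    (hc : 0 < c) (h : QuadBounded A T c) (x : H) :
    (aInner A ((T * T) x) x).re ≤ c ^ 2 * aSeminorm A x ^ 2 := by
  set u := (c : ℂ) • x + T x with hu
  set v := (c : ℂ) • x - T x with hv
  -- Since `(c - T)u = (c² - T²)x = (c + T)v` and `u + v = 2cx`, the right side is `⟨(c² - T²)x | u
  -- + v⟩_A`. Both brackets have nonnegative real part by `h`.
  have key : (2 * c : ℂ) * (c ^ 2 * (aSeminorm A x : ℂ) ^ 2 - aInner A ((T * T) x) x) =
      (c * (aSeminorm A u : ℂ) ^ 2 - aInner A (T u) u) +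
        (c * (aSeminorm A v : ℂ) ^ 2 + aInner A (T v) v) := by
    simp only [← aInner_self hA, hu, hv, mul_apply_eq_comp, map_add, map_sub, map_smul,
      aInner_add_left, aInner_add_right, aInner_sub_left, aInner_sub_right, aInner_smul_left,
      aInner_smul_right, Complex.conj_ofReal]
    ring
  have hre := congrArg Complex.re key
  have e1 := (Complex.re_le_norm _).trans (h u)
  have e2 := (neg_le_of_abs_le ((Complex.abs_re_le_norm _).trans (h v)))
  norm_cast at hre
  simp only [Complex.add_re, Complex.sub_re, Complex.re_ofReal_mul, Complex.ofReal_re] at hre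
  have : 0 ≤ 2 * c * (c ^ 2 * aSeminorm A x ^ 2 - (aInner A ((T * T) x) x).re) := by
    rw [hre]; linarith
  linarith [nonneg_of_mul_nonneg_right this (by positivity : 0 < 2 * c)]

/-- The power inequality for squares. -/
theorem QuadBounded.mul_self {T : H →L[ℂ] H} {c : ℝ} (hA : A.IsPositive) (hc : 0 < c)
    (h : QuadBounded A T c) : QuadBounded A (T * T) (c ^ 2) := by
  intro x
  set w := aInner A ((T * T) x) x with hw
  obtain ⟨z, hz, hzw⟩ : ∃ z : ℂ, ‖z‖ = 1 ∧ z ^ 2 * w = ‖w‖ := by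
    -- Half the angle, because `T * T` picks up `z ^ 2` when `T` is replaced by `z • T`.
    refine ⟨Complex.exp (((-(w.arg / 2) : ℝ) : ℂ) * Complex.I), Complex.norm_exp_ofReal_mul_I _, ?_⟩
    nth_rw 2 [← Complex.norm_mul_exp_arg_mul_I w]
    rw [← Complex.exp_nat_mul, mul_left_comm, ← Complex.exp_add]
    have : ((2 : ℕ) : ℂ) * (((-(w.arg / 2) : ℝ) : ℂ) * Complex.I) + w.arg * Complex.I = 0 := by
      push_cast; ring
    rw [this, Complex.exp_zero, mul_one]
  have hzT : QuadBounded A (z • T) c := by simpa [hz] using h.smul z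
  have := hzT.re_aInner_mul_self_le hA hc x
  have e : aInner A ((z • T * z • T) x) x = (‖w‖ : ℂ) := by
    rw [← hzw, smul_mul_smul_comm, smul_apply, aInner_smul_left, sq]
  rwa [e, Complex.ofReal_re] at this

theorem QuadBounded.mul_add_mul {T S : H →L[ℂ] H} {a b : ℝ} (hA : A.IsPositive)
    (ha : 0 ≤ a) (hb : 0 ≤ b) (hT : T ∈ aBounded A) (hS : S ∈ aBounded A)
    (hTa : QuadBounded A T a) (hSb : QuadBounded A S b) :
    QuadBounded A (T * S + S * T) (4 * a * b) := by
  rcases (mul_nonneg ha hb).eq_or_lt' with h0 | h0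
  -- When `ab = 0` the division by `2ab` below fails, but the crude bound `8ab` is already `0`.
  · have := (hTa.mul hA ha hb hT hS hSb).add (hSb.mul hA hb ha hS hT hTa)
    rwa [show 4 * a * b + 4 * b * a = 4 * a * b by linear_combination 4 * h0] at this
  -- With the common bound `ab`, each square is bounded by `(2ab)²`; the total `8(ab)²` over `2ab`
  -- is `4ab`.
  have h1 : QuadBounded A ((b : ℂ) • T) (a * b) := by
    simpa [abs_of_nonneg hb, mul_comm] using hTa.smul (b : ℂ)
  have h2 : QuadBounded A ((a : ℂ) • S) (a * b) := by
    simpa [abs_of_nonneg ha] using hSb.smul (a : ℂ)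
  have h3 := ((h1.add h2).mul_self hA (by positivity)).sub
    ((h1.sub h2).mul_self hA (by positivity))
  have e : ((b : ℂ) • T + (a : ℂ) • S) * ((b : ℂ) • T + (a : ℂ) • S) -
      ((b : ℂ) • T - (a : ℂ) • S) * ((b : ℂ) • T - (a : ℂ) • S) =
      (2 * (a * b) : ℂ) • (T * S + S * T) := by
    simp only [mul_add, add_mul, mul_sub, sub_mul, smul_mul_smul_comm]
    module
  rw [e] at h3
  intro x
  have := h3 x
  rw [smul_apply, aInner_smul_left, norm_mul] at this
  have n : ‖(2 * (a * b) : ℂ)‖ = 2 * (a * b) := by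
    simp [abs_of_nonneg ha, abs_of_nonneg hb]
  rw [n] at this
  refine le_of_mul_le_mul_left ?_ (by positivity : 0 < 2 * (a * b))
  linear_combination this

theorem aNumRadius_ne_top (hA : A.IsPositive) {T : H →L[ℂ] H} (hT : T ∈ aBounded A) :
    aNumRadius A T ≠ ⊤ := by
  obtain ⟨c, hc0, hc⟩ := (mem_aBounded_iff hA T).1 hT
  have h : QuadBounded A T (NNReal.mk c hc0.le) := fun x => by
    have := mul_le_mul_of_nonneg_right (hc x) (aSeminorm_nonneg A x)
    exact (norm_aInner_le hA _ _).trans (this.trans_eq (by rw [sq, mul_assoc, NNReal.coe_mk]))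
  exact ne_top_of_le_ne_top ENNReal.coe_ne_top h.aNumRadius_le

/-- Homogeneity covers `‖x‖_A ≠ 0`. Vectors with `‖x‖_A = 0` are not seen by the supremum; for them
Cauchy–Schwarz makes the form vanish. -/
theorem quadBounded_toNNReal_aNumRadius (hA : A.IsPositive) {T : H →L[ℂ] H}
    (hT : T ∈ aBounded A) : QuadBounded A T (aNumRadius A T).toNNReal := by
  intro x
  rcases (aSeminorm_nonneg A x).eq_or_lt' with h0 | h0
  · simpa [h0] using norm_aInner_le hA (T x) x
  set t := aSeminorm A x with ht
  have h1 : aSeminorm A (((t⁻¹ : ℝ) : ℂ) • x) = 1 := by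
    rw [aSeminorm_smul hA, Complex.norm_real, Real.norm_of_nonneg (inv_nonneg.2 h0.le)]
    exact inv_mul_cancel₀ h0.ne'
  have h2 : ‖aInner A (T (((t⁻¹ : ℝ) : ℂ) • x)) (((t⁻¹ : ℝ) : ℂ) • x)‖ₑ ≤ aNumRadius A T :=
    le_iSup₂ (f := fun (y : H) (_ : aSeminorm A y = 1) => ‖aInner A (T y) y‖ₑ) _ h1
  rw [← ENNReal.coe_toNNReal (aNumRadius_ne_top hA hT), enorm_eq_nnnorm, ENNReal.coe_le_coe,
    ← NNReal.coe_le_coe, coe_nnnorm, map_smul, aInner_smul_left, aInner_smul_right,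
    Complex.conj_ofReal, norm_mul, norm_mul, Complex.norm_real,
    Real.norm_of_nonneg (inv_nonneg.2 h0.le)] at h2
  have h3 := mul_le_mul_of_nonneg_left h2 (sq_nonneg t)
  have h4 : t ^ 2 * (t⁻¹ * (t⁻¹ * ‖aInner A (T x) x‖)) = ‖aInner A (T x) x‖ := by
    field_simp
  rwa [h4, mul_comm] at h3

end SemiHilbert

theorem mainTheorem6 {H : Type*} [NormedAddCommGroup H] [InnerProductSpace ℂ H] [CompleteSpace H]
    (A : H →L[ℂ] H) (hA : A.IsPositive) (T S : H →L[ℂ] H)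
    (hT : T ∈ SemiHilbert.aBounded A) (hS : S ∈ SemiHilbert.aBounded A) :
    SemiHilbert.aNumRadius A (T * S) ≤
        4 * SemiHilbert.aNumRadius A T * SemiHilbert.aNumRadius A S ∧
      SemiHilbert.aNumRadius A (T * S + S * T) ≤
        4 * SemiHilbert.aNumRadius A T * SemiHilbert.aNumRadius A S ∧
      (T * S = S * T →
        SemiHilbert.aNumRadius A (T * S) ≤
          2 * SemiHilbert.aNumRadius A T * SemiHilbert.aNumRadius A S) := by
  have hTa := SemiHilbert.quadBounded_toNNReal_aNumRadius hA hT
  have hSb := SemiHilbert.quadBounded_toNNReal_aNumRadius hA hS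
  rw [← ENNReal.coe_toNNReal (SemiHilbert.aNumRadius_ne_top hA hT),
    ← ENNReal.coe_toNNReal (SemiHilbert.aNumRadius_ne_top hA hS)]
  generalize (SemiHilbert.aNumRadius A T).toNNReal = a at hTa
  generalize (SemiHilbert.aNumRadius A S).toNNReal = b at hSb
  have hsum := hTa.mul_add_mul hA a.coe_nonneg b.coe_nonneg hT hS hSb
  refine ⟨?_, ?_, fun hcomm => ?_⟩
  · have h := hTa.mul hA a.coe_nonneg b.coe_nonneg hT hS hSb
    exact_mod_cast SemiHilbert.QuadBounded.aNumRadius_le (a := 4 * a * b) (by exact_mod_cast h)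
  · exact_mod_cast SemiHilbert.QuadBounded.aNumRadius_le (a := 4 * a * b) (by exact_mod_cast hsum)
  · have h : SemiHilbert.QuadBounded A (T * S) (2 * a * b : NNReal) := fun x => by
      have hx := hsum x
      rw [← hcomm, add_apply, SemiHilbert.aInner_add_left, ← two_mul,
        norm_mul, Complex.norm_ofNat] at hx
      rw [NNReal.coe_mul, NNReal.coe_mul, NNReal.coe_ofNat]
      linear_combination hx / 2
    exact_mod_cast h.aNumRadius_le
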